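/- Let $n \ge 2$ and let $X_1,\dots,X_n,Y_1,\dots,Y_n$ be $2n$ independent random variables, each uniformly distributed on $[0,1]$. For $1\le i\le n$ let $I_i$ be the closed interval with endpoints $X_i$ and $Y_i$, that is, $I_i=[\min(X_i,Y_i),\max(X_i,Y_i)]$, and let $G$ be the graph with vertex set $\{1,\dots,n\}$ in which two different vertices $i,j$ are adjacent if and only if $I_i\cap I_j\ne\emptyset$ (the random interval graph on $n$ vertices). Let $\Delta(G)$ denote the maximum degree of $G$. Then $$P(\Delta(G)=n-1)=\frac{2}{3}.$$ In other words, with probability exactly $2/3$ some interval $I_i$ meets all the other intervals $I_j$, $j\ne i$. -/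

import Mathlib

open MeasureTheory ProbabilityTheory

/-- The intersection graph of a family of sets of reals: two different vertices are adjacent
if and only if the sets attached to them have non-empty intersection. When every `I v` is an
interval this is the interval graph of the family. -/
def intervalGraph {V : Type*} (I : V → Set ℝ) : SimpleGraph V where
  Adj v w := v ≠ w ∧ (I v ∩ I w).Nonempty
  symm := ⟨fun _ _ h => ⟨h.1.symm, by rw [Set.inter_comm]; exact h.2⟩⟩
  loopless := ⟨fun _ h => h.1 rfl⟩

noncomputable instance {V : Type*} (I : V → Set ℝ) : DecidableRel (intervalGraph I).Adj :=
  Classical.decRel _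

/-- The random interval attached to vertex `i`: it is `[X i, Y i]` if `X i ≤ Y i`
and `[Y i, X i]` if `Y i ≤ X i`. -/
def randomInterval {Ω : Type*} {n : ℕ} (X Y : Fin n → Ω → ℝ) (ω : Ω) (i : Fin n) : Set ℝ :=
  Set.uIcc (X i ω) (Y i ω)

/-- The random interval graph on `n` vertices built from the endpoints `X i`, `Y i`. -/
abbrev randomIntervalGraph {Ω : Type*} {n : ℕ} (X Y : Fin n → Ω → ℝ) (ω : Ω) :
    SimpleGraph (Fin n) :=
  intervalGraph (randomInterval X Y ω)

/-! ### Peeling a matching from the middle outwards. -/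

section Peeling

open Finset Equiv

variable {α : Type*} [LinearOrder α]

/-! Almost surely the 2n end points are distinct, and all their orderings are equally likely. It
remains to show that two thirds of the matchings of 2n ordered points have an interval meeting all
the others, a hub.

Split the points into a lower half `L` and an upper half, and remove matched pairs from the middle
outwards: the pair of the innermost left point while equally many points survive on both sides, that
of the innermost right point otherwise. Stop at four points a < b < c < d. By
`hasHub_iff_of_isPeeled` a hub exists exactly when a is not matched to b.

The peeling consults only the partners of removed points, so rematching the last four leaves it
unchanged (`peel_iterate_congr`). Cycling b, c, d therefore groups the matchings in threes with one
failure each (`three_mul_card_hasHub`), and `measure_hubSet` turns this count into a probability. -/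

/-- The innermost point of `T` on the left side `L` when both sides of `T` have the same size,
and the innermost point on the right side otherwise. -/
def pivots (L T : Finset α) : Finset α :=
  if #(T ∩ L) = #(T \ L) then {x ∈ T ∩ L | ∀ y ∈ T ∩ L, y ≤ x}
  else {x ∈ T \ L | ∀ y ∈ T \ L, x ≤ y}

/-- Remove the innermost point and its partner under the matching `s`. -/
def peel (L : Finset α) (s : Perm α) (T : Finset α) : Finset α :=
  {x ∈ T | x ∉ pivots L T ∧ s x ∉ pivots L T}

/-- The invariants of the peeling process of a matching `s`, where `T` is the set of points
that have not been removed. -/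
structure IsPeeled (L : Finset α) (s : Perm α) (T : Finset α) : Prop where
  closed : ∀ x ∈ T, s x ∈ T
  card : #(T ∩ L) = #(T \ L) ∨ #(T ∩ L) + 2 = #(T \ L)
  left : ∀ x ∉ T, x ∈ L → s x ∈ L → ∀ t ∈ T, t ∈ L → t < x ∨ t < s x
  right : ∀ x ∉ T, x ∉ L → s x ∉ L → ∀ t ∈ T, t ∉ L → x < t ∨ s x < t
  exists_left : #(T ∩ L) = #(T \ L) ∨ ∃ y, y ∈ L ∧ s y ∈ L
  cross : ∀ x ∉ T, x ∈ L → s x ∉ L → (∀ t ∈ T, t ∉ L → s x < t) ∨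
    ((∀ t ∈ T, t ∈ L → t < x) ∧
      (#(T ∩ L) = #(T \ L) ∨ ∃ y, y ∈ L ∧ s y ∈ L ∧ y < x ∧ s y < x))

theorem exists_pivot {L T : Finset α}
    (hc : #(T ∩ L) = #(T \ L) ∨ #(T ∩ L) + 2 = #(T \ L)) (hT : T.Nonempty) :
    ∃ a ∈ T, pivots L T = {a} ∧
      ((#(T ∩ L) = #(T \ L) ∧ a ∈ L ∧ ∀ t ∈ T, t ∈ L → t ≤ a) ∨
       (#(T ∩ L) + 2 = #(T \ L) ∧ a ∉ L ∧ ∀ t ∈ T, t ∉ L → a ≤ t)) := by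
  have hsum := card_inter_add_card_sdiff T L
  have hpos := hT.card_pos
  by_cases h : #(T ∩ L) = #(T \ L)
  · obtain ⟨a, ha, hmax⟩ := exists_max_image (T ∩ L) id (card_pos.1 (by omega))
    simp only [id] at hmax
    refine ⟨a, (mem_inter.1 ha).1, ?_, .inl ⟨h, (mem_inter.1 ha).2,
      fun t h1 h2 => hmax t (mem_inter.2 ⟨h1, h2⟩)⟩⟩
    ext x
    simp only [pivots, if_pos h, mem_filter, mem_singleton]
    exact ⟨fun hx => le_antisymm (hmax x hx.1) (hx.2 a ha), fun hx => hx ▸ ⟨ha, hmax⟩⟩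
  · obtain ⟨a, ha, hmin⟩ := exists_min_image (T \ L) id (card_pos.1 (by omega))
    simp only [id] at hmin
    refine ⟨a, (mem_sdiff.1 ha).1, ?_, .inr ⟨hc.resolve_left h, (mem_sdiff.1 ha).2,
      fun t h1 h2 => hmin t (mem_sdiff.2 ⟨h1, h2⟩)⟩⟩
    ext x
    simp only [pivots, if_neg h, mem_filter, mem_singleton]
    exact ⟨fun hx => le_antisymm (hx.2 a ha) (hmin x hx.1), fun hx => hx ▸ ⟨ha, hmin⟩⟩

theorem peel_eq_erase {L T : Finset α} {s : Perm α} (hs : ∀ x, s (s x) = x) {a : α}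
    (ha : pivots L T = {a}) : peel L s T = (T.erase a).erase (s a) := by
  ext x
  have : s x = a ↔ x = s a := ⟨fun h => by rw [← h, hs], fun h => by rw [h, hs]⟩
  simp only [peel, ha, mem_filter, mem_singleton, mem_erase, this]
  tauto

theorem card_erase_erase_inter {L T : Finset α} {a b : α} (hab : a ≠ b) (ha : a ∈ T) (hb : b ∈ T) :
    #((T.erase a).erase b ∩ L) + (if a ∈ L then 1 else 0) + (if b ∈ L then 1 else 0)
      = #(T ∩ L) := by
  have h : (T.erase a).erase b ∩ L = ((T ∩ L).erase a).erase b := by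
    ext; simp only [mem_inter, mem_erase]; tauto
  have h1 := card_erase_add_one (s := T ∩ L) (a := a)
  have h2 := card_erase_add_one (s := (T ∩ L).erase a) (a := b)
  rw [h]
  split_ifs with haL hbL hbL
  · rw [← h1 (by simp [*]), ← h2 (by simp [*, hab.symm])]
  · rw [← h1 (by simp [*]), erase_eq_of_notMem (by simp [*])]
  · rw [erase_eq_of_notMem (s := T ∩ L) (by simp [*])] at *
    rw [← h2 (by simp [*])]
  · rw [erase_eq_of_notMem (s := T ∩ L) (by simp [*]), erase_eq_of_notMem (by simp [*]),
      add_zero, add_zero]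

theorem card_erase_erase_sdiff {L T : Finset α} {a b : α} (hab : a ≠ b) (ha : a ∈ T) (hb : b ∈ T) :
    #((T.erase a).erase b \ L) + (if a ∈ L then 0 else 1) + (if b ∈ L then 0 else 1)
      = #(T \ L) := by
  have h1 := card_erase_erase_inter (L := L) hab ha hb
  have h2 := card_inter_add_card_sdiff T L
  have h3 := card_inter_add_card_sdiff ((T.erase a).erase b) L
  have h4 := card_erase_add_one ha
  have h5 := card_erase_add_one (s := T.erase a) (a := b) (by simp [*, hab.symm])
  split_ifs at * <;> omega

theorem card_peel {L T : Finset α} {s : Perm α} (hs : ∀ x, s (s x) = x) (hs' : ∀ x, s x ≠ x)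
    (h : IsPeeled L s T) (hT : T.Nonempty) : #(peel L s T) + 2 = #T := by
  obtain ⟨a, haT, ha, -⟩ := exists_pivot h.card hT
  have h4 := card_erase_add_one haT
  have h5 := card_erase_add_one (s := T.erase a) (a := s a) (by simp [hs', h.closed a haT])
  rw [peel_eq_erase hs ha]
  omega

/-- A pair removed at balance contains the largest surviving left point. If it crosses, balance
persists and the remaining left points lie below its left end; if it lies in `L`, the right side
gains an excess of two and the pair is the witness for `exists_left` and `cross`. A pair removed out
of balance contains the smallest surviving right point, and restores balance exactly when both its
ends are on the right. -/
theorem IsPeeled.peel {L T : Finset α} {s : Perm α} (hs : ∀ x, s (s x) = x) (hs' : ∀ x, s x ≠ x)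
    (h : IsPeeled L s T) (hT : T.Nonempty) : IsPeeled L s (peel L s T) := by
  obtain ⟨a, haT, ha, hcase⟩ := exists_pivot h.card hT
  have hsaT := h.closed a haT
  have hi := card_erase_erase_inter (L := L) (hs' a).symm haT hsaT
  have hd := card_erase_erase_sdiff (L := L) (hs' a).symm haT hsaT
  rw [peel_eq_erase hs ha]
  set T' := (T.erase a).erase (s a) with hT'
  have mem' : ∀ x, x ∈ T' ↔ x ≠ s a ∧ x ≠ a ∧ x ∈ T := fun x => by simp [hT']
  have hout : ∀ x ∉ T', x ∉ T ∨ x = a ∨ x = s a := fun x hx => by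
    rw [mem'] at hx; tauto
  have hsub : ∀ x ∈ T', x ∈ T := fun x hx => ((mem' x).1 hx).2.2
  have hlt : ∀ t ∈ T', t ∈ L → t < a ∨ ¬ ∀ t ∈ T, t ∈ L → t ≤ a := fun t ht htL => by
    by_contra! hh
    exact hh.1.not_gt (lt_of_le_of_ne (hh.2 t (hsub t ht) htL) ((mem' t).1 ht).2.1)
  have hgt : ∀ t ∈ T', t ∉ L → a < t ∨ ¬ ∀ t ∈ T, t ∉ L → a ≤ t := fun t ht htL => by
    by_contra! hh
    exact hh.1.not_gt (lt_of_le_of_ne (hh.2 t (hsub t ht) htL) ((mem' t).1 ht).2.1.symm)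
  have hss := hs a
  refine ⟨?_, ?_, ?_, ?_, ?_, ?_⟩
  · intro x hx
    rw [mem'] at hx ⊢
    refine ⟨fun h1 => hx.2.1 (s.injective h1), fun h1 => hx.1 ?_, h.closed x hx.2.2⟩
    rw [← h1, hs]
  · rcases hcase with ⟨hb, haL, -⟩ | ⟨hb, haL, -⟩ <;> by_cases hsa : s a ∈ L <;>
      simp only [haL, hsa, if_true, if_false] at hi hd <;> omega
  · intro x hx hxL hsxL t ht htL
    rcases hout x hx with hx | rfl | rfl
    · exact h.left x hx hxL hsxL t (hsub t ht) htL
    · grind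
    · grind
  · intro x hx hxL hsxL t ht htL
    rcases hout x hx with hx | rfl | rfl
    · exact h.right x hx hxL hsxL t (hsub t ht) htL
    · grind
    · grind
  · rcases h.exists_left with hb | hy
    · by_cases hsa : s a ∈ L
      · rcases hcase with ⟨-, haL, -⟩ | ⟨hb', -⟩
        · exact .inr ⟨a, haL, hsa⟩
        · omega
      · left
        rcases hcase with ⟨hb, haL, -⟩ | ⟨hb', haL, -⟩ <;>
          simp only [haL, hsa, if_true, if_false] at hi hd <;> omega
    · exact .inr hy
  · intro x hx hxL hsxL
    rcases hout x hx with hx | rfl | rfl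
    · rcases h.cross x hx hxL hsxL with h1 | ⟨h1, h2⟩
      · exact .inl fun t ht => h1 t (hsub t ht)
      · refine .inr ⟨fun t ht => h1 t (hsub t ht), ?_⟩
        rcases h2 with hb | hy
        · rcases hcase with ⟨-, haL, -⟩ | ⟨hb', -⟩
          · by_cases hsa : s a ∈ L
            · exact .inr ⟨a, haL, hsa, h1 a haT haL, h1 _ hsaT hsa⟩
            · left
              simp only [haL, hsa, if_true, if_false] at hi hd
              omega
          · omega
        · exact .inr hy
    · rcases hcase with ⟨hb, haL, hm⟩ | ⟨hb, haL, -⟩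
      · refine .inr ⟨fun t ht htL => (hlt t ht htL).resolve_right (not_not.2 hm), .inl ?_⟩
        simp only [haL, hsxL, if_true, if_false] at hi hd
        omega
      · exact absurd hxL haL
    · rw [hs] at hsxL ⊢
      rcases hcase with ⟨hb, haL, hm⟩ | ⟨hb, haL, hm⟩
      · exact absurd haL hsxL
      · exact .inl fun t ht htL => (hgt t ht htL).resolve_right (not_not.2 hm)

theorem isPeeled_univ [Fintype α] {L : Finset α} (s : Perm α)
    (hL : 2 * #L = Fintype.card α) : IsPeeled L s univ := by
  have h := card_inter_add_card_sdiff (univ : Finset α) L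
  have hc : #(univ ∩ L) = #(univ \ L) := by
    rw [univ_inter, card_univ] at *
    omega
  exact ⟨by simp, .inl hc, by simp, by simp, .inl hc, by simp⟩

theorem isPeeled_iterate [Fintype α] {L : Finset α} {s : Perm α} (hs : ∀ x, s (s x) = x)
    (hs' : ∀ x, s x ≠ x) (hc : 2 * #L = Fintype.card α) (k : ℕ)
    (hk : 2 * k ≤ Fintype.card α) :
    IsPeeled L s ((peel L s)^[k] univ) ∧ #((peel L s)^[k] univ) + 2 * k = Fintype.card α := by
  induction k with
  | zero => exact ⟨isPeeled_univ s hc, by simp⟩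
  | succ k ih =>
    obtain ⟨h1, h2⟩ := ih (by omega)
    have hne : ((peel L s)^[k] univ).Nonempty := card_pos.1 (by omega)
    rw [Function.iterate_succ_apply']
    have := card_peel hs hs' h1 hne
    exact ⟨h1.peel hs hs' hne, by omega⟩

/-- Changing the matching on the points that survive the peeling does not affect the peeling. -/
theorem peel_iterate_congr [Fintype α] {L : Finset α} {s s' : Perm α} (k : ℕ)
    (h : ∀ x ∉ (peel L s)^[k] univ, s' x = s x)
    (h' : ∀ x ∈ (peel L s)^[k] univ, s x ∈ (peel L s)^[k] univ ∧ s' x ∈ (peel L s)^[k] univ) :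
    (peel L s')^[k] univ = (peel L s)^[k] univ := by
  have hanti : ∀ j, (peel L s)^[j + 1] univ ⊆ (peel L s)^[j] univ := fun j => by
    rw [Function.iterate_succ_apply']
    exact filter_subset _ _
  have hmono : Antitone fun j => (peel L s)^[j] univ := antitone_nat_of_succ_le hanti
  suffices H : ∀ j ≤ k, (peel L s')^[j] univ = (peel L s)^[j] univ from H k le_rfl
  intro j
  induction j with
  | zero => intro; rfl
  | succ j ih =>
    intro hj
    rw [Function.iterate_succ_apply', Function.iterate_succ_apply', ih (by omega)]
    set T := (peel L s)^[j] univ with hT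
    -- A point surviving all k rounds is never a pivot, so it does not matter which survivor it is
    -- matched to.
    have hp : ∀ x ∈ (peel L s)^[k] univ, x ∉ pivots L T := fun x hx => by
      have := hmono hj hx
      simp only [Function.iterate_succ_apply', ← hT] at this
      exact (mem_filter.1 this).2.1
    refine filter_congr fun x _ => ?_
    by_cases hx : x ∈ (peel L s)^[k] univ
    · simp [hp _ (h' x hx).1, hp _ (h' x hx).2]
    · rw [h x hx]

/-! ### The hub criterion on the last four points. -/

/-- A family of intervals given by a matching of their end points has a member that meets
all the others. -/
def HasHub (s : Perm α) : Prop :=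
  ∃ x, ∀ y, (Set.uIcc x (s x) ∩ Set.uIcc y (s y)).Nonempty

theorem uIcc_inter_uIcc_nonempty {β : Type*} [LinearOrder β] (a b c d : β) :
    (Set.uIcc a b ∩ Set.uIcc c d).Nonempty ↔
      (a ≤ c ∨ a ≤ d ∨ b ≤ c ∨ b ≤ d) ∧ (c ≤ a ∨ c ≤ b ∨ d ≤ a ∨ d ≤ b) := by
  rw [Set.uIcc, Set.uIcc, Set.Icc_inter_Icc, Set.nonempty_Icc]
  have h1 : a ⊓ b ≤ a ⊔ b := inf_le_sup
  have h2 : c ⊓ d ≤ c ⊔ d := inf_le_sup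
  simp only [sup_le_iff, le_inf_iff]
  simp only [h1, h2, true_and, and_true]
  simp only [inf_le_iff, le_sup_iff]
  tauto

/-- If a is matched to c or d, its interval spans the gap between the halves, so it meets every
crossing interval; by `left` and `right` it also reaches every removed one-sided pair. If a is
matched to b, then c is matched to d, and every interval misses {a, b}, {c, d} or some pair inside
`L`. -/
theorem hasHub_iff_of_isPeeled {L : Finset α} {s : Perm α} (hs : ∀ x, s (s x) = x)
    (hs' : ∀ x, s x ≠ x) (hL : ∀ x ∈ L, ∀ y ∉ L, x < y) {a b c d : α} (hab : a < b) (hbc : b < c)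
    (hcd : c < d) (h : IsPeeled L s {a, b, c, d}) : HasHub s ↔ s a ≠ b := by
  have hac := hab.trans hbc
  have had := hac.trans hcd
  have hbd := hbc.trans hcd
  -- The two allowed balances leave {a, b} or only {a} in `L`.
  have hsides : a ∈ L ∧ c ∉ L ∧ d ∉ L ∧
      (#({a, b, c, d} ∩ L) = #({a, b, c, d} \ L) → b ∈ L) := by
    have hcard := h.card
    have hba : b ∈ L → a ∈ L := fun hb => by_contra fun ha => (hL b hb a ha).not_gt hab
    have hcb : c ∈ L → b ∈ L := fun hb => by_contra fun ha => (hL c hb b ha).not_gt hbc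
    have hdc : d ∈ L → c ∈ L := fun hb => by_contra fun ha => (hL d hb c ha).not_gt hcd
    rw [← filter_mem_eq_inter, ← filter_notMem_eq_sdiff] at hcard ⊢
    by_cases ha : a ∈ L <;> by_cases hb : b ∈ L <;> by_cases hc : c ∈ L <;> by_cases hd : d ∈ L <;>
      simp_all [filter_insert, filter_singleton, hab.ne, hac.ne, had.ne, hbc.ne, hbd.ne, hcd.ne]
  obtain ⟨haL, hcL, hdL, hbL⟩ := hsides
  have hsa : s a = b ∨ s a = c ∨ s a = d := by
    have h1 := h.closed a (by simp)
    have h2 := hs' a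
    simp only [mem_insert, mem_singleton] at h1
    tauto
  have hcross : ∀ x y, x ∈ L → s x ∉ L → y ∈ L → s y ∉ L →
      (Set.uIcc x (s x) ∩ Set.uIcc y (s y)).Nonempty := fun x y h1 h2 h3 h4 =>
    (uIcc_inter_uIcc_nonempty _ _ _ _).2
      ⟨.inr (.inl (hL _ h1 _ h4).le), .inr (.inl (hL _ h3 _ h2).le)⟩
  have hswap : ∀ y, Set.uIcc (s y) (s (s y)) = Set.uIcc y (s y) := fun y => by
    rw [hs, Set.uIcc_comm]
  constructor
  · rintro ⟨x, hx⟩ hsab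
    have hsb : s b = a := by rw [← hsab, hs]
    have hsc : s c = d := by
      have h1 := h.closed c (by simp)
      have h2 := hs' c
      simp only [mem_insert, mem_singleton] at h1
      rcases h1 with h1 | h1 | h1 | h1
      · have := hs c; rw [h1, hsab] at this; exact absurd this hbc.ne
      · have := hs c; rw [h1, hsb] at this; exact absurd this hac.ne
      · exact absurd h1 h2
      · exact h1
    have hsd : s d = c := by rw [← hsc, hs]
    have hright : ∀ x, x < c → x < d → s x < c → s x < d →
        ¬ (Set.uIcc x (s x) ∩ Set.uIcc c (s c)).Nonempty := fun x h1 h2 h3 h4 => by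
      rw [uIcc_inter_uIcc_nonempty, hsc]
      grind
    have hleft : ∀ x y, y < x → s y < x → y < s x → s y < s x →
        ¬ (Set.uIcc x (s x) ∩ Set.uIcc y (s y)).Nonempty := fun x y h1 h2 h3 h4 => by
      rw [uIcc_inter_uIcc_nonempty]
      grind
    have key : ∀ x, x ∈ L → ∃ y, ¬ (Set.uIcc x (s x) ∩ Set.uIcc y (s y)).Nonempty := by
      intro x hxL
      have hxc := hL x hxL c hcL
      have hxd := hL x hxL d hdL
      by_cases hsx : s x ∈ L
      · exact ⟨c, hright x hxc hxd (hL _ hsx c hcL) (hL _ hsx d hdL)⟩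
      by_cases hxT : x ∈ ({a, b, c, d} : Finset α)
      · refine ⟨c, hright x hxc hxd ?_ ?_⟩ <;>
        · simp only [mem_insert, mem_singleton] at hxT
          rcases hxT with rfl | rfl | rfl | rfl
          · rwa [hsab]
          · rwa [hsb]
          · exact absurd hxL hcL
          · exact absurd hxL hdL
      -- A removed crossing interval lies left of {c, d}, or right of {a, b} at balance, or right of
      -- another pair inside `L`.
      · rcases h.cross x hxT hxL hsx with h1 | ⟨h1, h2 | ⟨y, hy, hsy, hyx, hsyx⟩⟩
        · exact ⟨c, hright x hxc hxd (h1 c (by simp) hcL) (h1 d (by simp) hdL)⟩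
        · have hbL' := hbL h2
          refine ⟨a, hleft x a (h1 a (by simp) haL) ?_ (hL _ haL _ hsx) ?_⟩
          · rw [hsab]; exact h1 b (by simp) hbL'
          · rw [hsab]; exact hL _ hbL' _ hsx
        · exact ⟨y, hleft x y hyx hsyx (hL _ hy _ hsx) (hL _ hsy _ hsx)⟩
    by_cases hxL : x ∈ L
    · obtain ⟨y, hy⟩ := key x hxL
      exact hy (hx y)
    by_cases hsx : s x ∈ L
    · obtain ⟨y, hy⟩ := key (s x) hsx
      rw [hswap] at hy
      exact hy (hx y)
    obtain ⟨y, hy, hsy⟩ : ∃ y, y ∈ L ∧ s y ∈ L := by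
      rcases h.exists_left with h1 | h1
      · exact ⟨a, haL, hsab ▸ hbL h1⟩
      · exact h1
    exact hleft x y (hL _ hy _ hxL) (hL _ hsy _ hxL) (hL _ hy _ hsx) (hL _ hsy _ hsx) (hx y)
  · intro hne
    have hsac : c ≤ s a := by
      rcases hsa with h1 | h1 | h1
      · exact absurd h1 hne
      · exact h1.ge
      · exact h1 ▸ hcd.le
    have hsaL : s a ∉ L := by
      rcases hsa with h1 | h1 | h1
      · exact absurd h1 hne
      · rwa [h1]
      · rwa [h1]
    refine ⟨a, fun y => ?_⟩
    by_cases hyT : y ∈ ({a, b, c, d} : Finset α)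
    · have h1 := h.closed y hyT
      have h2 := hs' y
      have h3 := hs y
      rw [uIcc_inter_uIcc_nonempty]
      have hay : ∀ z ∈ ({a, b, c, d} : Finset α), a ≤ z := by
        simp [hab.le, hac.le, had.le]
      refine ⟨.inl (hay y hyT), ?_⟩
      simp only [mem_insert, mem_singleton] at hyT h1
      have hsac' : b ≤ s a := hbc.le.trans hsac
      rcases hsa with h4 | h4 | h4
      · exact absurd h4 hne
      all_goals
        have h5 := hs a
        rw [h4] at h5 hsac hsac' ⊢
        rcases hyT with rfl | rfl | rfl | rfl <;> grind
    · by_cases hyL : y ∈ L <;> by_cases hsy : s y ∈ L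
      · rw [uIcc_inter_uIcc_nonempty]
        have := hL _ hyL _ hsaL
        have := h.left y hyT hyL hsy a (by simp) haL
        grind
      · exact hcross a y haL hsaL hyL hsy
      · rw [← hswap y]
        exact hcross a (s y) haL hsaL hsy (by rwa [hs])
      · rw [uIcc_inter_uIcc_nonempty]
        have := hL _ haL _ hyL
        have := h.right y hyT hyL hsy (s a) (h.closed a (by simp)) hsaL
        grind

/-- A permutation cycling the three upper elements of a four element set. -/
theorem exists_cycle (T : Finset α) (hT : #T = 4) :
    ∃ a b c d : α, ∃ g : Perm α, a < b ∧ b < c ∧ c < d ∧ T = {a, b, c, d} ∧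
      (∀ x ∉ T, g x = x) ∧ (∀ x ∈ T, g x ∈ T) ∧ g a = a ∧ g b = c ∧ g c = d ∧ g d = b ∧
      g ^ 3 = 1 := by
  let e := T.orderEmbOfFin hT
  have h01 : e 0 < e 1 := e.strictMono (by decide)
  have h12 : e 1 < e 2 := e.strictMono (by decide)
  have h23 : e 2 < e 3 := e.strictMono (by decide)
  have h02 := h01.trans h12
  have h03 := h02.trans h23
  have h13 := h12.trans h23
  have hTe : T = {e 0, e 1, e 2, e 3} := by
    have h4 : (univ : Finset (Fin 4)) = {0, 1, 2, 3} := rfl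
    rw [← T.image_orderEmbOfFin_univ hT, h4]
    simp only [image_insert, image_singleton]
    rfl
  have hg : ∀ x, (swap (e 1) (e 2) * swap (e 2) (e 3)) x =
      if x = e 1 then e 2 else if x = e 2 then e 3 else if x = e 3 then e 1 else x := by
    intro x
    simp only [Perm.mul_apply, swap_apply_def]
    grind
  generalize swap (e 1) (e 2) * swap (e 2) (e 3) = g at hg
  refine ⟨e 0, e 1, e 2, e 3, g, h01, h12, h23, hTe, ?_, ?_, ?_, ?_, ?_, ?_, ?_⟩
  · intro x hx
    rw [hTe] at hx
    simp only [mem_insert, mem_singleton] at hx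
    grind
  · intro x hx
    rw [hTe] at hx ⊢
    simp only [mem_insert, mem_singleton] at hx ⊢
    grind
  · grind
  · grind
  · grind
  · grind
  · ext x
    simp only [pow_succ, pow_zero, one_mul, Perm.mul_apply, Perm.one_apply]
    grind

end Peeling

/-! ### Counting matchings in groups of three. -/

section Counting

open Finset Equiv

/-- The indicator of `P` summed over x, φ x, φ (φ x) is 1 at each x, and the bijection φ makes the
three total sums equal. -/
theorem three_mul_card_filter {β : Type*} [Fintype β] (φ : β → β) (hφ : ∀ x, φ (φ (φ x)) = x)
    (P : β → Prop) [DecidablePred P]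
    (hP : ∀ x, (P x ∧ ¬ P (φ x) ∧ ¬ P (φ (φ x))) ∨ (¬ P x ∧ P (φ x) ∧ ¬ P (φ (φ x))) ∨
      (¬ P x ∧ ¬ P (φ x) ∧ P (φ (φ x)))) :
    3 * #{x | P x} = Fintype.card β := by
  let e : Perm β := ⟨φ, fun x => φ (φ x), hφ, hφ⟩
  let w : β → ℕ := fun x => if P x then 1 else 0
  have h1 : ∑ x, w (φ x) = ∑ x, w x := Equiv.sum_comp e w
  have h2 : ∑ x, w (φ (φ x)) = ∑ x, w x := (Equiv.sum_comp e fun x => w (φ x)).trans h1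
  have h3 : ∑ x, (w x + w (φ x) + w (φ (φ x))) = Fintype.card β := by
    rw [← card_univ, card_eq_sum_ones]
    refine sum_congr rfl fun x _ => ?_
    rcases hP x with ⟨h, h', h''⟩ | ⟨h, h', h''⟩ | ⟨h, h', h''⟩ <;> simp [w, h, h', h'']
  rw [sum_add_distrib, sum_add_distrib, h1, h2] at h3
  rw [card_filter]
  change 3 * ∑ x, w x = _
  omega

variable {α : Type*} [LinearOrder α]

theorem exists_lower_half [Fintype α] {n : ℕ} (hc : Fintype.card α = 2 * n) :
    ∃ L : Finset α, (∀ x ∈ L, ∀ y ∉ L, x < y) ∧ #L = n := by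
  let e := Fintype.orderIsoFinOfCardEq α hc
  refine ⟨({i : Fin (2 * n) | (i : ℕ) < n} : Finset _).map e.toEquiv.toEmbedding, ?_, ?_⟩
  · intro x hx y hy
    simp only [mem_map_equiv, mem_filter, mem_univ, true_and, not_lt] at hx hy
    have : e.symm x < e.symm y := Fin.lt_def.2 (lt_of_lt_of_le hx hy)
    exact e.symm.lt_iff_lt.1 this
  · rw [card_map, Fin.card_filter_val_lt]
    omega

/-- Among the conjugates of a perfect matching of `2 * n` points, exactly two thirds have an
interval that meets all the others. -/
theorem three_mul_card_hasHub [Fintype α] {n : ℕ} (hn : 2 ≤ n)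
    (hc : Fintype.card α = 2 * n) (p : Perm α) (hp : ∀ x, p (p x) = x) (hp' : ∀ x, p x ≠ x)
    [DecidablePred fun τ : Perm α => HasHub (τ * p * τ⁻¹)] :
    3 * #{τ : Perm α | HasHub (τ * p * τ⁻¹)} = 2 * Fintype.card (Perm α) := by
  obtain ⟨L, hL, hLc⟩ := exists_lower_half hc
  let σ : Perm α → Perm α := fun τ => τ * p * τ⁻¹
  have hσ : ∀ τ x, σ τ (σ τ x) = x := fun τ x => by simp [σ, hp]
  have hσ' : ∀ τ x, σ τ x ≠ x := fun τ x h => hp' (τ⁻¹ x) <| by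
    rwa [Perm.eq_inv_iff_eq]
  let T : Perm α → Finset α := fun τ => (peel L (σ τ))^[n - 2] univ
  have hT : ∀ τ, IsPeeled L (σ τ) (T τ) ∧ #(T τ) = 4 := fun τ => by
    -- Each round removes two points, so n - 2 rounds leave four.
    obtain ⟨h1, h2⟩ := isPeeled_iterate (L := L) (hσ τ) (hσ' τ) (by omega) (n - 2) (by omega)
    exact ⟨h1, by change #(T τ) + _ = _ at h2; omega⟩
  have : Nonempty α := Fintype.card_pos_iff.1 (by omega)
  choose! a b c d g hab hbc hcd hTe hg hg' hga hgb hgc hgd hg3 using exists_cycle (α := α)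
  let φ : Perm α → Perm α := fun τ => g (T τ) * τ
  have hσφ : ∀ τ x, σ (φ τ) (g (T τ) x) = g (T τ) (σ τ x) := fun τ x => by simp [σ, φ]
  have hTφ : ∀ τ, T (φ τ) = T τ := fun τ => by
    obtain ⟨h1, h2⟩ := hT τ
    have hsurj : ∀ x ∈ T τ, ∃ y ∈ T τ, g (T τ) y = x := fun x hx => by
      refine ⟨g (T τ) (g (T τ) x), hg' _ h2 _ (hg' _ h2 _ hx), ?_⟩
      simpa [pow_succ] using congrArg (fun f : Perm α => f x) (hg3 _ h2)
    refine peel_iterate_congr (n - 2) (fun x hx => ?_) fun x hx => ⟨h1.closed x hx, ?_⟩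
    · have hx' : σ τ x ∉ T τ := fun h => hx (hσ τ x ▸ h1.closed _ h)
      have := hσφ τ x
      rwa [hg _ h2 x hx, hg _ h2 _ hx'] at this
    · obtain ⟨y, hy, rfl⟩ := hsurj x hx
      rw [hσφ]
      exact hg' _ h2 _ (h1.closed y hy)
  -- Since `T` is unchanged by φ, the same 3-cycle is applied all three times.
  have hφ : ∀ τ, φ (φ (φ τ)) = τ := fun τ => by
    change g (T (φ (φ τ))) * (g (T (φ τ)) * (g (T τ) * τ)) = τ
    rw [hTφ, hTφ, ← mul_assoc, ← mul_assoc, ← pow_two, ← pow_succ, hg3 _ (hT τ).2, one_mul]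
  have hub : ∀ τ, HasHub (σ τ) ↔ σ τ (a (T τ)) ≠ b (T τ) := fun τ => by
    obtain ⟨h1, h2⟩ := hT τ
    refine hasHub_iff_of_isPeeled (hσ τ) (hσ' τ) hL (hab _ h2) (hbc _ h2) (hcd _ h2) ?_
    rwa [← hTe _ h2]
  have hval : ∀ τ, σ (φ τ) (a (T τ)) = g (T τ) (σ τ (a (T τ))) := fun τ => by
    rw [← hσφ, hga _ (hT τ).2]
  have hval₂ : ∀ τ, σ (φ (φ τ)) (a (T τ)) = g (T τ) (g (T τ) (σ τ (a (T τ)))) := fun τ => by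
    rw [← hval, ← hTφ, hval]
  -- The cycle fixes a, so along τ, φ τ, φ (φ τ) the partner of a takes each of the values b, c, d
  -- once.
  have hbad := three_mul_card_filter φ hφ (fun τ => ¬ HasHub (σ τ)) fun τ => by
    obtain ⟨h1, h2⟩ := hT τ
    simp only [hub, hTφ, hval, hval₂, not_not, ne_eq]
    have h3 := h1.closed (a (T τ)) ((Finset.ext_iff.1 (hTe _ h2) _).2 (mem_insert_self _ _))
    have h4 := hσ' τ (a (T τ))
    have h5 := hbc _ h2
    have h6 := hcd _ h2
    have h7 := h5.trans h6
    generalize σ τ (a (T τ)) = v at *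
    rw [hTe _ h2] at h3
    simp only [mem_insert, mem_singleton] at h3
    rcases h3 with h | h | h | h
    · exact absurd h h4
    all_goals
      rw [h]
      simp [hgb _ h2, hgc _ h2, hgd _ h2, h5.ne', h7.ne']
  have hadd := card_filter_add_card_filter_not (s := (univ : Finset (Perm α)))
    (fun τ => HasHub (τ * p * τ⁻¹))
  rw [card_univ] at hadd
  change 3 * #{τ | ¬ HasHub (τ * p * τ⁻¹)} = _ at hbad
  omega

end Counting

/-! ### From counting to probability. -/

section Exchangeability

variable {ι Ω : Type*} [MeasurableSpace Ω] {μ : Measure Ω} [IsProbabilityMeasure μ]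

/-- The set of real vectors for which one of the intervals given by the matching `p` of the
coordinates meets all the others. -/
def hubSet (p : Equiv.Perm ι) : Set (ι → ℝ) :=
  {z | ∃ x, ∀ y, (Set.uIcc (z x) (z (p x)) ∩ Set.uIcc (z y) (z (p y))).Nonempty}

/-- Coordinate i of `z ∘ τ` sits at position τ i, so the matching p of coordinates becomes its
conjugate on positions. -/
theorem comp_mem_hubSet_iff [LinearOrder ι] {z : ι → ℝ} (hz : ∀ i j, z i ≤ z j ↔ i ≤ j)
    (p τ : Equiv.Perm ι) : z ∘ τ ∈ hubSet p ↔ HasHub (τ * p * τ⁻¹) := by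
  simp only [hubSet, HasHub, Set.mem_ofPred_eq, uIcc_inter_uIcc_nonempty, Function.comp, hz]
  refine τ.exists_congr fun x => τ.forall_congr fun y => ?_
  simp

theorem ae_ne_of_indepFun {X Y : Ω → ℝ} (hX : Measurable X) (hY : Measurable Y)
    (h : IndepFun X Y μ) [NullSingletonClass (μ.map Y)] : ∀ᵐ ω ∂μ, X ω ≠ Y ω := by
  have hd : MeasurableSet {q : ℝ × ℝ | q.1 = q.2} :=
    measurableSet_eq_fun measurable_fst measurable_snd
  have : IsProbabilityMeasure (μ.map Y) := Measure.isProbabilityMeasure_map hY.aemeasurable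
  have hmap := (indepFun_iff_map_prod_eq_prod_map_map hX.aemeasurable hY.aemeasurable).1 h
  have h0 : μ.map (fun ω => (X ω, Y ω)) {q : ℝ × ℝ | q.1 = q.2} = 0 := by
    rw [hmap, Measure.prod_apply hd]
    refine (lintegral_congr fun x => ?_).trans lintegral_zero
    have : Prod.mk x ⁻¹' {q : ℝ × ℝ | q.1 = q.2} = {x} := by
      ext y
      simp [eq_comm]
    rw [this, measure_singleton]
  rw [Measure.map_apply (hX.prodMk hY) hd] at h0
  simpa [ae_iff] using h0

variable [Fintype ι]

theorem measurableSet_hubSet (p : Equiv.Perm ι) : MeasurableSet (hubSet p) := by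
  have h (i j : ι) : MeasurableSet {z : ι → ℝ | z i ≤ z j} :=
    measurableSet_le (measurable_pi_apply i) (measurable_pi_apply j)
  simp only [hubSet, uIcc_inter_uIcc_nonempty]
  simp only [Set.ofPred_exists, Set.ofPred_forall]
  exact .iUnion fun x => .iInter fun y =>
    ((h _ _).union ((h _ _).union ((h _ _).union (h _ _)))).inter
      ((h _ _).union ((h _ _).union ((h _ _).union (h _ _))))

open Finset in
open Classical in
theorem three_mul_card_comp_mem_hubSet {n : ℕ} (hn : 2 ≤ n) (hc : Fintype.card ι = 2 * n)
    (p : Equiv.Perm ι) (hp : ∀ x, p (p x) = x) (hp' : ∀ x, p x ≠ x) {z : ι → ℝ}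
    (hz : z.Injective) :
    3 * #{τ : Equiv.Perm ι | z ∘ τ ∈ hubSet p} = 2 * Fintype.card (Equiv.Perm ι) := by
  -- Ordering the indices by their values makes `z` an order embedding by definition.
  let : LinearOrder ι := LinearOrder.lift' z hz
  have h : ∀ i j, z i ≤ z j ↔ i ≤ j := fun _ _ => Iff.rfl
  simp only [comp_mem_hubSet_iff h]
  convert three_mul_card_hasHub hn hc p hp hp'

/-- Both joint laws are the product of copies of ν. -/
theorem map_precomp_perm {Z : ι → Ω → ℝ} (hZ : ∀ i, Measurable (Z i)) (hind : iIndepFun Z μ)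
    {ν : Measure ℝ} (hν : ∀ i, μ.map (Z i) = ν) (τ : Equiv.Perm ι) :
    μ.map (fun ω i => Z (τ i) ω) = μ.map (fun ω i => Z i ω) := by
  have h := (iIndepFun_iff_map_fun_eq_pi_map fun i => (hZ (τ i)).aemeasurable).1
    (hind.precomp τ.injective)
  have h' := (iIndepFun_iff_map_fun_eq_pi_map fun i => (hZ i).aemeasurable).1 hind
  simp only [hν] at h h'
  exact h.trans h'.symm

theorem ae_injective {Z : ι → Ω → ℝ} (hZ : ∀ i, Measurable (Z i)) (hind : iIndepFun Z μ)
    (hν : ∀ i, NullSingletonClass (μ.map (Z i))) : ∀ᵐ ω ∂μ, Function.Injective fun i => Z i ω := by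
  have h : ∀ᵐ ω ∂μ, ∀ i j, i ≠ j → Z i ω ≠ Z j ω := by
    rw [ae_all_iff]
    intro i
    rw [ae_all_iff]
    intro j
    by_cases hij : i = j
    · simp [hij]
    · filter_upwards [ae_ne_of_indepFun (hZ i) (hZ j) (hind.indepFun hij)] with ω hω _ using hω
  filter_upwards [h] with ω hω i j hij
  exact by_contra fun hne => hω i j hne hij

/-- By exchangeability every relabelling τ gives the same probability. Summed over τ, these form the
expectation of a count that almost surely equals two thirds of all permutations. -/
theorem measure_hubSet {n : ℕ} (hn : 2 ≤ n) (hc : Fintype.card ι = 2 * n)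
    (p : Equiv.Perm ι) (hp : ∀ x, p (p x) = x) (hp' : ∀ x, p x ≠ x)
    {Z : ι → Ω → ℝ} (hZ : ∀ i, Measurable (Z i)) (hind : iIndepFun Z μ)
    {ν : Measure ℝ} [NullSingletonClass ν] (hν : ∀ i, μ.map (Z i) = ν) :
    μ {ω | (fun i => Z i ω) ∈ hubSet p} = 2 / 3 := by
  classical
  set P := μ {ω | (fun i => Z i ω) ∈ hubSet p} with hP
  have hE := measurableSet_hubSet p
  have hmeas (τ : Equiv.Perm ι) : MeasurableSet {ω | (fun i => Z (τ i) ω) ∈ hubSet p} :=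
    (measurable_pi_lambda _ fun i => hZ (τ i)) hE
  have hperm (τ : Equiv.Perm ι) : μ {ω | (fun i => Z (τ i) ω) ∈ hubSet p} = P := by
    have h := congrArg (fun m => m (hubSet p)) (map_precomp_perm hZ hind hν τ)
    rwa [Measure.map_apply (measurable_pi_lambda _ fun i => hZ (τ i)) hE,
      Measure.map_apply (measurable_pi_lambda _ hZ) hE] at h
  have hsum : ∑ τ : Equiv.Perm ι, μ {ω | (fun i => Z (τ i) ω) ∈ hubSet p} =
      ∫⁻ ω, ((Finset.univ.filter fun τ : Equiv.Perm ι =>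
        (fun i => Z i ω) ∘ τ ∈ hubSet p).card : ENNReal) ∂μ := by
    simp only [Finset.card_filter, Nat.cast_sum]
    rw [lintegral_finsetSum]
    · refine Finset.sum_congr rfl fun τ _ => ?_
      rw [← lintegral_indicator_one (hmeas τ)]
      refine lintegral_congr fun ω => ?_
      simp [Set.indicator_apply, Function.comp_def]
    · intro τ _
      simp only [Nat.cast_ite, Nat.cast_one, Nat.cast_zero]
      exact Measurable.ite (hmeas τ) measurable_const measurable_const
  set N := Fintype.card (Equiv.Perm ι) with hN
  have hcount : (3 : ENNReal) * ((N : ENNReal) * P) = 2 * N := by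
    have h1 : (N : ENNReal) * P = ∑ τ : Equiv.Perm ι, μ {ω | (fun i => Z (τ i) ω) ∈ hubSet p} := by
      simp [hperm, hN, Finset.card_univ]
    rw [h1, hsum, ← lintegral_const_mul' _ _ (by norm_num)]
    have h2 : ∀ᵐ ω ∂μ, (3 : ENNReal) * ((Finset.univ.filter fun τ : Equiv.Perm ι =>
        (fun i => Z i ω) ∘ τ ∈ hubSet p).card : ENNReal) = 2 * N := by
      filter_upwards [ae_injective hZ hind fun i => by rw [hν]; infer_instance] with ω hω
      exact_mod_cast three_mul_card_comp_mem_hubSet hn hc p hp hp' hω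
    rw [lintegral_congr_ae h2]
    simp
  have hN0 : (N : ENNReal) ≠ 0 := by
    exact_mod_cast Fintype.card_ne_zero
  rw [ENNReal.eq_div_iff (by norm_num) (by norm_num)]
  refine (ENNReal.mul_right_inj hN0 (ENNReal.natCast_ne_top N)).1 ?_
  rw [mul_comm (N : ENNReal) 2, ← hcount]
  ring

end Exchangeability

/-! ### Back to the random interval graph. -/

theorem maxDegree_eq_card_sub_one_iff {V : Type*} [Fintype V] [Nonempty V] (G : SimpleGraph V)
    [DecidableRel G.Adj] :
    G.maxDegree = Fintype.card V - 1 ↔ ∃ v, ∀ w, w ≠ v → G.Adj v w := by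
  classical
  have hlt := G.maxDegree_lt_card_verts
  have hiff (v : V) : G.degree v = Fintype.card V - 1 ↔ ∀ w, w ≠ v → G.Adj v w :=
    (G.degree_eq_card_sub_one v).trans (forall_congr' fun w => by rw [ne_comm])
  constructor
  · intro h
    obtain ⟨v, hv⟩ := G.exists_maximal_degree_vertex
    exact ⟨v, (hiff v).1 (hv ▸ h)⟩
  · rintro ⟨v, hv⟩
    have := G.degree_le_maxDegree v
    rw [(hiff v).2 hv] at this
    omega

theorem theorem4p4 {Ω : Type*} [MeasurableSpace Ω] (μ : Measure Ω) [IsProbabilityMeasure μ]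
    (n : ℕ) (hn : 2 ≤ n) (X Y : Fin n → Ω → ℝ)
    (hX : ∀ i, Measurable (X i)) (hY : ∀ i, Measurable (Y i))
    (hXunif : ∀ i, pdf.IsUniform (X i) (Set.Icc 0 1) μ volume)
    (hYunif : ∀ i, pdf.IsUniform (Y i) (Set.Icc 0 1) μ volume)
    (hindep : iIndepFun (Sum.elim X Y) μ) :
    μ {ω | (randomIntervalGraph X Y ω).maxDegree = n - 1} = 2 / 3 ∧
    μ {ω | ∃ i, ∀ j, j ≠ i →
      (randomInterval X Y ω i ∩ randomInterval X Y ω j).Nonempty} = 2 / 3 := by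
  have : Nonempty (Fin n) := ⟨⟨0, by omega⟩⟩
  have hdeg : {ω | (randomIntervalGraph X Y ω).maxDegree = n - 1} = {ω | ∃ i, ∀ j, j ≠ i →
      (randomInterval X Y ω i ∩ randomInterval X Y ω j).Nonempty} := by
    ext ω
    have h := maxDegree_eq_card_sub_one_iff (randomIntervalGraph X Y ω)
    rw [Fintype.card_fin] at h
    rw [Set.mem_ofPred_eq, Set.mem_ofPred_eq, h]
    exact exists_congr fun i => forall_congr' fun j =>
      ⟨fun hh hj => (hh hj).2, fun hh hj => ⟨hj.symm, hh hj⟩⟩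
  -- Swapping the summands matches `X i` with `Y i`. In `hubSet` each interval then occurs twice,
  -- once per end point, and is also compared with itself; neither changes the condition.
  have hhub : {ω | ∃ i, ∀ j, j ≠ i →
      (randomInterval X Y ω i ∩ randomInterval X Y ω j).Nonempty} =
      {ω | (fun i => Sum.elim X Y i ω) ∈ hubSet (Equiv.sumComm (Fin n) (Fin n))} := by
    ext ω
    have hself (i : Fin n) :
        (Set.uIcc (X i ω) (Y i ω) ∩ Set.uIcc (X i ω) (Y i ω)).Nonempty := by simp
    have hne (i : Fin n) : (∀ j, j ≠ i →
        (Set.uIcc (X i ω) (Y i ω) ∩ Set.uIcc (X j ω) (Y j ω)).Nonempty) ↔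
        ∀ j, (Set.uIcc (X i ω) (Y i ω) ∩ Set.uIcc (X j ω) (Y j ω)).Nonempty :=
      ⟨fun h j => (eq_or_ne j i).elim (fun hj => hj ▸ hself i) (h j), fun h j _ => h j⟩
    have hcomm (i : Fin n) : Set.uIcc (Y i ω) (X i ω) = Set.uIcc (X i ω) (Y i ω) :=
      Set.uIcc_comm _ _
    simp [hubSet, randomInterval, hne, hcomm]
  have hP : μ {ω | (fun i => Sum.elim X Y i ω) ∈ hubSet (Equiv.sumComm (Fin n) (Fin n))}
      = 2 / 3 := by
    have : NullSingletonClass (cond (volume : Measure ℝ) (Set.Icc 0 1)) :=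
      ⟨fun x => cond_absolutelyContinuous (measure_singleton x)⟩
    refine measure_hubSet hn (by simp [two_mul]) _ (by simp) (by simp) ?_ hindep
      (ν := cond volume (Set.Icc 0 1)) ?_
    · rintro (i | i)
      exacts [hX i, hY i]
    · rintro (i | i)
      exacts [hXunif i, hYunif i]
  exact ⟨by rw [hdeg, hhub, hP], by rw [hhub, hP]⟩
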